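/- An oriented abelian group is an abelian group $(A,+,-,0)$ with a strict cyclic ternary relation $\mathcal{O}$, i.e. a relation holding only of triples of pairwise distinct elements with $\mathcal{O}(a,b,c)\Rightarrow\mathcal{O}(b,c,a)$, such that $\mathcal{O}(a,b,c)\Rightarrow\mathcal{O}(a+d,b+d,c+d)$ and such that $x<_0y:\Leftrightarrow x\ne y\wedge\mathcal{O}(0,x,y)$ is a strict linear order on $A\setminus\{0\}$. It is regularly dense if for every prime $p$ and all $a,b\in A$ with $\mathcal{O}(0,a,b)$ there is $c\in A$ with $\mathcal{O}(a,pc,b)$ and $ic<_0(i+1)c$ for $1\le i\le p-1$. Write $[p]A$ for the cardinality of $A/pA$, and let $e(A,p)$ be the least $e\in\mathbb{N}$ such that $\{a\in A: p^{e+k}a=0\}=\{a\in A: p^{e}a=0\}$ for all $k\in\mathbb{N}$, with $e(A,p)=\infty$ if there is no such $e$. For $e\in\{0,\infty\}$ let $T(\vec 0,\vec e)$ be the theory, in the language $L_{\mathcal{O}}=\{+,-,0,\mathcal{O}\}$, whose models are the regularly dense oriented abelian groups $A$ such that $[p]A=1$ and $e(A,p)=e$ for every prime $p$. For an $L_{\mathcal{O}}$-formula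 $\psi(\vec x;\vec y)$ with $|\vec x|=m$, $|\vec y|=n$ and a model $A$, consider the set system $\{\psi(A^m;\vec b):\vec b\in A^n\}$ on $A^m$, and its shatter function $\pi_\psi(t)=\max\{|\{B\cap\psi(A^m;\vec b):\vec b\in A^n\}| : B\subseteq A^m,\ |B|=t\}$. The VC-density of $\psi$ in $A$ is the infimum of the real numbers $r\ge 0$ such that $\pi_\psi(t)=O(t^r)$ as $t\to\infty$ (and $\infty$ if there is no such $r$). Then for $e\in\{0,\infty\}$, in every model of $T(\vec 0,\vec e)$, every partitioned $L_{\mathcal{O}}$-formula $\psi(\vec x;\vec y)$ has VC-density at most $|\vec y|$. -/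

import Mathlib

open FirstOrder

namespace OrientedGroups

/-! ## Oriented abelian groups -/

/-- An oriented abelian group: an abelian group with a (strict) cyclic ternary relation `orient`
that is invariant under translation and for which `{(x, y) | x ≠ y ∧ orient 0 x y}` is a strict
linear order on `A ∖ {0}`. The reading of `orient a b c` is: going counterclockwise from `a` one
meets `b` strictly before `c`; as usual for cyclic orders it holds of distinct points only. -/
class OrientedAddCommGroup (A : Type*) extends AddCommGroup A where
  /-- The orientation. -/
  orient : A → A → A → Prop
  orient_ne : ∀ a b c : A, orient a b c → a ≠ b ∧ b ≠ c ∧ a ≠ c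
  orient_cyclic : ∀ a b c : A, orient a b c → orient b c a
  orient_add : ∀ a b c d : A, orient a b c → orient (a + d) (b + d) (c + d)
  orient_linear : IsStrictTotalOrder {x : A // x ≠ 0}
    (fun x y => (x : A) ≠ (y : A) ∧ orient 0 (x : A) (y : A))

open OrientedAddCommGroup

section Invariants

variable (A : Type*)

/-- The strict linear order `x <₀ y` on the nonzero elements. -/
def lt0 {A : Type*} [OrientedAddCommGroup A] (x y : A) : Prop :=
  x ≠ 0 ∧ y ≠ 0 ∧ x ≠ y ∧ orient 0 x y

/-- Regular density: for every prime `p` and all `a`, `b` with `orient 0 a b` there is `c` with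
`orient a (p • c) b` and `c <₀ 2c <₀ ⋯ <₀ pc`. -/
def IsRegularlyDense [OrientedAddCommGroup A] : Prop :=
  ∀ p : ℕ, p.Prime → ∀ a b : A, orient 0 a b →
    ∃ c : A, orient a (p • c) b ∧
      ∀ i : ℕ, 1 ≤ i → i ≤ p - 1 → lt0 (i • c) ((i + 1) • c)

/-- The subgroup `pA = {p • a | a ∈ A}`. -/
def multiples [AddCommGroup A] (p : ℕ) : AddSubgroup A :=
  (nsmulAddMonoidHom (α := A) p).range

/-- The invariant `[p]A`: the number of elements of `A / pA`, which is `⊤` if it is infinite. -/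
noncomputable def indexInv [AddCommGroup A] (p : ℕ) : ℕ∞ :=
  ENat.card (A ⧸ multiples A p)

/-- The `m`-torsion subgroup `{a | m • a = 0}`. -/
def tor [AddCommGroup A] (m : ℕ) : AddSubgroup A :=
  (nsmulAddMonoidHom (α := A) m).ker

/-- The invariant `e(A, p)`: the place at which the chain `Tor_{p^0}(A) ≤ Tor_{p^1}(A) ≤ ⋯`
becomes constant, and `⊤` if it never does. -/
noncomputable def torsionInv [AddCommGroup A] (p : ℕ) : ℕ∞ :=
  sInf {e : ℕ∞ | ∃ n : ℕ, e = n ∧ ∀ k : ℕ, tor A (p ^ (n + k)) = tor A (p ^ n)}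

/-- `A` is a model of the theory `T(d, e)`: it is a regularly dense oriented abelian group with
`[p]A = p ^ d_p` (where `p ^ ⊤ = ⊤`) and `e(A, p) = e_p` for every prime `p`. -/
structure IsModelT (d e : Nat.Primes → ℕ∞) [OrientedAddCommGroup A] : Prop where
  regularlyDense : IsRegularlyDense A
  index : ∀ p : Nat.Primes, indexInv A p = ((p : ℕ) : ℕ∞) ^ d p
  torsion : ∀ p : Nat.Primes, torsionInv A p = e p

end Invariants

/-! ## The language `L_O = {+, -, 0, O}` -/

/-- The function symbols of `L_O`. -/
inductive LOFunc : ℕ → Type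
  | zero : LOFunc 0
  | neg : LOFunc 1
  | add : LOFunc 2

/-- The relation symbol of `L_O`. -/
inductive LORel : ℕ → Type
  | orient : LORel 3

/-- The language `L_O` of oriented abelian groups. -/
def LO : Language where
  Functions := LOFunc
  Relations := LORel

/-- An oriented abelian group as an `L_O`-structure. -/
instance structureLO (A : Type*) [OrientedAddCommGroup A] : LO.Structure A where
  funMap {n} f :=
    match n, f with
    | _, LOFunc.zero => fun _ => 0
    | _, LOFunc.neg => fun v => -v 0
    | _, LOFunc.add => fun v => v 0 + v 1
  RelMap {n} r :=
    match n, r with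
    | _, LORel.orient => fun v => orient (v 0) (v 1) (v 2)

/-! ## VC-density -/

/-- The traces `B ∩ S`, with `S ∈ 𝒮`, on a finite set `B`. -/
def traces {X : Type*} (𝒮 : Set (Set X)) (B : Finset X) : Set (Set X) :=
  {C | ∃ S ∈ 𝒮, C = (B : Set X) ∩ S}

/-- The shatter function `t ↦ max {|{B ∩ S : S ∈ 𝒮}| : B ⊆ X, |B| = t}` of a set system. -/
noncomputable def shatterFunction {X : Type*} (𝒮 : Set (Set X)) (t : ℕ) : ℕ :=
  sSup {k : ℕ | ∃ B : Finset X, B.card = t ∧ k = (traces 𝒮 B).ncard}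

theorem traces_subset {X : Type*} (𝒮 : Set (Set X)) (B : Finset X) :
    traces 𝒮 B ⊆ 𝒫 (B : Set X) := by
  rintro C ⟨S, -, rfl⟩
  exact Set.inter_subset_left

theorem traces_ncard_le {X : Type*} (𝒮 : Set (Set X)) (B : Finset X) :
    (traces 𝒮 B).ncard ≤ 2 ^ B.card := by
  have h := Set.ncard_le_ncard (traces_subset 𝒮 B) B.finite_toSet.powerset
  rwa [Set.ncard_powerset _ B.finite_toSet, Set.ncard_coe_finset] at h

/-- The supremum in `shatterFunction` is taken over a bounded set of natural numbers. -/
theorem bddAbove_traces {X : Type*} (𝒮 : Set (Set X)) (t : ℕ) :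
    BddAbove {k : ℕ | ∃ B : Finset X, B.card = t ∧ k = (traces 𝒮 B).ncard} := by
  refine ⟨2 ^ t, ?_⟩
  rintro k ⟨B, rfl, rfl⟩
  exact traces_ncard_le 𝒮 B

/-- The VC-density of a set system: the infimum of the real numbers `r ≥ 0` such that the shatter
function at `t` is `O(t ^ r)`, and `⊤` if there is no such `r`. -/
noncomputable def vcDensity {X : Type*} (𝒮 : Set (Set X)) : ENNReal :=
  sInf {s : ENNReal | ∃ r : NNReal, s = r ∧
    (fun t : ℕ => (shatterFunction 𝒮 t : ℝ)) =O[Filter.atTop] (fun t : ℕ => (t : ℝ) ^ (r : ℝ))}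

/-- The set system `{ψ(M^m; b) : b ∈ M^n}` on `M^m` that a partitioned formula `ψ(x; y)`, with
`|x| = m` and `|y| = n`, defines in a structure `M`. -/
def definedFamily {L : Language} (M : Type*) [L.Structure M] {m n : ℕ}
    (ψ : L.Formula (Fin m ⊕ Fin n)) : Set (Set (Fin m → M)) :=
  {S | ∃ b : Fin n → M, S = {a : Fin m → M | ψ.Realize (Sum.elim a b)}}

end OrientedGroups

/-! Unroll the circle. The cover `UnivCover A` is an ordered abelian group `G` with a positive
element `u` such that `A` is `G ⧸ ℤu`, and points of `A` correspond to their lifts in `[0, u)`. Two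
properties of `G` carry the proof. Divisibility of `A` (this is `[p]A = 1`) gives `G = nG + ℤu`, so
there are at most `n` classes modulo `nG` (`exists_residue`). Regular density, for `A` nontrivial,
makes every `nG` dense in `G` (`denseMultiples`).

Density yields a back-and-forth argument (`exists_transport`, `exists_similar_snoc`), so that the
truth of a formula at a tuple depends only on the classes of its lifts modulo some `NG` and on the
signs of finitely many integer affine forms in these lifts (`isTame_realize`).

Hence the trace of `ψ(x; b)` on a finite set `B` is determined by at most `N ^ n` classes and by the
signs of `|F| * |B|` affine forms in the `n` lifts of `b`. In an ordered group such forms have only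
`O(|B| ^ n)` sign patterns (`exists_sign_patterns`), whence the exponent `n = |y|`. -/

namespace OrientedGroups

open OrientedAddCommGroup

/-! ### Cutting the cyclic order at `0`, and the cocycle of the cut. -/

section CyclicOrder

variable {A : Type*} [OrientedAddCommGroup A]

theorem orient_zero_trans {x y z : A} (h₁ : orient 0 x y) (h₂ : orient 0 y z) :
    orient 0 x z := by
  have n₁ := orient_ne _ _ _ h₁
  have n₂ := orient_ne _ _ _ h₂
  have := (orient_linear (A := A)).trans ⟨x, n₁.1.symm⟩ ⟨y, n₂.1.symm⟩ ⟨z, n₂.2.2.symm⟩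
    ⟨n₁.2.1, h₁⟩ ⟨n₂.2.1, h₂⟩
  exact this.2

theorem orient_zero_asymm {x y : A} (h₁ : orient 0 x y) : ¬ orient 0 y x := fun h₂ =>
  (orient_ne _ _ _ (orient_zero_trans h₁ h₂)).2.1 rfl

theorem orient_zero_total {x y : A} (hx : x ≠ 0) (hy : y ≠ 0) (hxy : x ≠ y) :
    orient 0 x y ∨ orient 0 y x := by
  by_contra! h
  have := (orient_linear (A := A)).trichotomous ⟨x, hx⟩ ⟨y, hy⟩
    (fun h' => h.1 h'.2) (fun h' => h.2 h'.2)
  exact hxy (congrArg Subtype.val this)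

theorem orient_add_iff {a b c : A} (d : A) :
    orient (a + d) (b + d) (c + d) ↔ orient a b c := by
  refine ⟨fun h => ?_, orient_add a b c d⟩
  simpa using orient_add _ _ _ (-d) h

theorem orient_sub_iff {a b c : A} : orient 0 (b - a) (c - a) ↔ orient a b c := by
  rw [← orient_add_iff (a := 0) a]; simp

theorem orient_trans {a b c d : A} (h₁ : orient a b c) (h₂ : orient a c d) : orient a b d := by
  rw [← orient_sub_iff] at *
  exact orient_zero_trans h₁ h₂

theorem orient_asymm {a b c : A} (h₁ : orient a b c) : ¬ orient a c b := by
  rw [← orient_sub_iff] at *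
  exact orient_zero_asymm h₁

theorem orient_total {a b c : A} (hab : a ≠ b) (hac : a ≠ c) (hbc : b ≠ c) :
    orient a b c ∨ orient a c b := by
  simp only [← orient_sub_iff (a := a)]
  exact orient_zero_total (sub_ne_zero.2 hab.symm) (sub_ne_zero.2 hac.symm) (by simpa using hbc)

/-- If negation preserved the order of `x <₀ y`, translates of the two relations would close up to
the cycle `x < y < y - x < -x < -y < x - y < x`. -/
theorem orient_neg {x y : A} (h : orient 0 x y) : orient 0 (-y) (-x) := by
  have n := orient_ne _ _ _ h
  by_contra h'
  have h₀ : orient 0 (-x) (-y) :=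
    (orient_zero_total (neg_ne_zero.2 n.1.symm) (neg_ne_zero.2 n.2.2.symm)
      (by simpa using n.2.1)).resolve_right h'
  have e₁ : orient 0 (y - x) (-x) := by
    have := orient_add _ _ _ (-x) h
    simp only [add_neg_cancel, ← sub_eq_add_neg, zero_sub] at this
    exact orient_cyclic _ _ _ this
  have e₂ : orient 0 y (y - x) := by
    have := orient_add _ _ _ y h₀
    simp only [zero_add, neg_add_cancel] at this
    rw [neg_add_eq_sub] at this
    exact orient_cyclic _ _ _ (orient_cyclic _ _ _ this)
  have e₃ : orient 0 (-y) (x - y) := by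
    have := orient_add _ _ _ (-y) h
    simp only [add_neg_cancel, ← sub_eq_add_neg, zero_sub] at this
    exact orient_cyclic _ _ _ (orient_cyclic _ _ _ this)
  have e₄ : orient 0 (x - y) x := by
    have := orient_add _ _ _ x h₀
    simp only [zero_add, neg_add_cancel] at this
    rw [neg_add_eq_sub] at this
    exact orient_cyclic _ _ _ this
  have := orient_zero_trans (orient_zero_trans (orient_zero_trans e₁ h₀) e₃) e₄
  exact orient_zero_asymm (orient_zero_trans h e₂) this

/-- The linear order on an oriented group obtained by cutting the circle at `0`, which becomes the
least element. -/
@[reducible] noncomputable def cutOrder (A : Type*) [OrientedAddCommGroup A] : LinearOrder A where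
  le a b := a = 0 ∨ a = b ∨ orient 0 a b
  le_refl a := Or.inr (Or.inl rfl)
  le_trans a b c := by
    rintro (rfl | rfl | h) (rfl | rfl | h') <;> first | tauto | skip
    · exact absurd rfl (orient_ne _ _ _ h).2.2
    · exact Or.inr (Or.inr (orient_zero_trans h h'))
  le_antisymm a b := by
    intro h h'
    have e₁ : orient 0 b a → a ≠ 0 := fun e => (orient_ne _ _ _ e).2.2.symm
    have e₂ : orient 0 a b → b ≠ 0 := fun e => (orient_ne _ _ _ e).2.2.symm
    have e₃ : orient 0 a b → ¬ orient 0 b a := orient_zero_asymm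
    grind
  le_total a b := by
    by_cases ha : a = 0
    · tauto
    by_cases hb : b = 0
    · tauto
    by_cases hab : a = b
    · tauto
    have := orient_zero_total ha hb hab
    tauto
  toDecidableLE := Classical.decRel _

attribute [local instance] cutOrder

theorem cut_le_iff {a b : A} : a ≤ b ↔ a = 0 ∨ a = b ∨ orient 0 a b := Iff.rfl

theorem cut_zero_le (a : A) : 0 ≤ a := Or.inl rfl

theorem cut_lt_iff {a b : A} : a < b ↔ (a = 0 ∧ b ≠ 0) ∨ orient 0 a b := by
  rw [lt_iff_le_and_ne, cut_le_iff]
  constructor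
  · rintro ⟨rfl | rfl | h, h'⟩
    · exact Or.inl ⟨rfl, h'.symm⟩
    · exact absurd rfl h'
    · exact Or.inr h
  · rintro (⟨rfl, h⟩ | h)
    · exact ⟨Or.inl rfl, h.symm⟩
    · exact ⟨Or.inr (Or.inr h), (orient_ne _ _ _ h).2.1⟩

theorem orient_of_cut_lt {a b c : A} (hab : a < b) (hbc : b < c) : orient a b c := by
  rw [cut_lt_iff] at hab hbc
  rcases hbc with ⟨rfl, -⟩ | hbc
  · rcases hab with ⟨-, h⟩ | h
    · exact absurd rfl h
    · exact absurd rfl (orient_ne _ _ _ h).2.2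
  rcases hab with ⟨rfl, -⟩ | hab
  · exact hbc
  have hac := orient_zero_trans hab hbc
  rcases orient_total (orient_ne _ _ _ hab).2.1 (orient_ne _ _ _ hac).2.1
    (orient_ne _ _ _ hbc).2.1 with h | h
  · exact h
  · have h₁ := orient_cyclic _ _ _ h
    have h₂ := orient_trans (orient_cyclic _ _ _ h₁) (orient_cyclic _ _ _ hbc)
    exact absurd (orient_cyclic _ _ _ (orient_cyclic _ _ _ h₂)) (orient_zero_asymm hab)

theorem orient_iff_cut {a b c : A} :
    orient a b c ↔ (a < b ∧ b < c) ∨ (b < c ∧ c < a) ∨ (c < a ∧ a < b) := by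
  constructor
  · intro h
    have n := orient_ne _ _ _ h
    by_contra h'
    have : orient a c b := by
      rcases lt_or_gt_of_ne n.1 with h₁ | h₁ <;> rcases lt_or_gt_of_ne n.2.1 with h₂ | h₂ <;>
        rcases lt_or_gt_of_ne n.2.2 with h₃ | h₃ <;> first
        | exact absurd (by tauto) h'
        | exact orient_of_cut_lt ‹_› ‹_›
        | exact orient_cyclic _ _ _ (orient_of_cut_lt ‹_› ‹_›)
        | exact orient_cyclic _ _ _ (orient_cyclic _ _ _ (orient_of_cut_lt ‹_› ‹_›))
    exact orient_asymm h this
  · rintro (⟨h₁, h₂⟩ | ⟨h₁, h₂⟩ | ⟨h₁, h₂⟩)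
    · exact orient_of_cut_lt h₁ h₂
    · exact orient_cyclic _ _ _ (orient_cyclic _ _ _ (orient_of_cut_lt h₁ h₂))
    · exact orient_cyclic _ _ _ (orient_of_cut_lt h₁ h₂)

/-- `1` if the way from `a` counterclockwise to `b` passes through `0`, and `0` otherwise. -/
noncomputable def descent (a b : A) : ℤ := if b < a then 1 else 0

theorem ite_lt_cocycle {X : Type*} [LinearOrder X] (a b c : X) :
    (if b < a then 1 else 0) + (if c < b then 1 else 0) - (if c < a then 1 else 0) =
      open Classical in if ((a < c ∧ c < b) ∨ (c < b ∧ b < a) ∨ (b < a ∧ a < c)) ∨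
        (a = c ∧ a ≠ b) then (1 : ℤ) else 0 := by
  rcases lt_trichotomy a b with h₁ | h₁ | h₁ <;> rcases lt_trichotomy b c with h₂ | h₂ | h₂ <;>
    rcases lt_trichotomy a c with h₃ | h₃ | h₃ <;> grind

/-- `descent` depends on the cut at `0`, but its coboundary is expressed by `orient` and equality
alone. It is therefore translation invariant, which makes addition on the cover associative and
monotone. -/
theorem descent_cocycle_eq (a b c : A) :
    descent a b + descent b c - descent a c =
      open Classical in if orient a c b ∨ (a = c ∧ a ≠ b) then 1 else 0 := by
  rw [orient_iff_cut]
  refine (ite_lt_cocycle a b c).trans ?_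
  congr

theorem descent_add (a b c d : A) :
    descent (a + d) (b + d) + descent (b + d) (c + d) - descent (a + d) (c + d) =
      descent a b + descent b c - descent a c := by
  rw [descent_cocycle_eq, descent_cocycle_eq]
  congr 1
  simp only [orient_add_iff, ne_eq, add_left_inj]

theorem descent_zero (a : A) : descent 0 a = 0 := if_neg (cut_zero_le a).not_gt

theorem descent_self (a : A) : descent a a = 0 := if_neg (lt_irrefl a)

/-- The reflection `t ↦ a + b - t` reverses the orientation and exchanges `a` with `b` and `0` with
`a + b`. This is the symmetry of the carry, hence commutativity of the cover. -/
theorem descent_comm (a b : A) : descent a (a + b) = descent b (a + b) := by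
  have key : ∀ x y : A, orient 0 (x + y) x → orient 0 (x + y) y := fun x y h => by
    have := orient_add _ _ _ (x + y) (orient_neg h)
    simp only [zero_add, neg_add_cancel, neg_add_cancel_left] at this
    exact orient_cyclic _ _ _ (orient_cyclic _ _ _ this)
  have h₁ := descent_cocycle_eq 0 a (a + b)
  have h₂ := descent_cocycle_eq 0 b (a + b)
  rw [descent_zero, descent_zero, zero_add, sub_zero] at h₁ h₂
  rw [h₁, h₂]
  congr 1
  apply propext
  have e₁ := key a b
  have e₂ := key b a
  rw [add_comm b a] at e₂
  have e₃ : 0 = a + b → (0 = a ↔ 0 = b) := fun h => by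
    constructor <;> (rintro rfl; simpa using h)
  tauto

end CyclicOrder

/-! ### The universal cover as an ordered abelian group. -/

section Unrolling

/-- The underlying set `ℤ × A` of the universal cover of the oriented group `A`. -/
@[ext] structure UnivCover (A : Type*) where
  /-- The sheet. -/
  sheet : ℤ
  /-- The point of `A` below. -/
  pt : A

namespace UnivCover

variable {A : Type*} [OrientedAddCommGroup A]

attribute [local instance] cutOrder

/-- Addition with carry: the sheet goes up by one more when adding `y.pt` to `x.pt` wraps past `0`.
-/
noncomputable instance : Add (UnivCover A) :=
  ⟨fun x y => ⟨x.sheet + y.sheet + descent x.pt (x.pt + y.pt), x.pt + y.pt⟩⟩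

noncomputable instance : Zero (UnivCover A) := ⟨⟨0, 0⟩⟩

noncomputable instance : Neg (UnivCover A) := ⟨fun x => ⟨-x.sheet - descent x.pt 0, -x.pt⟩⟩

@[simp] theorem add_sheet (x y : UnivCover A) :
    (x + y).sheet = x.sheet + y.sheet + descent x.pt (x.pt + y.pt) := rfl
@[simp] theorem add_pt (x y : UnivCover A) : (x + y).pt = x.pt + y.pt := rfl
@[simp] theorem zero_sheet : (0 : UnivCover A).sheet = 0 := rfl
@[simp] theorem zero_pt : (0 : UnivCover A).pt = 0 := rfl
@[simp] theorem neg_sheet (x : UnivCover A) : (-x).sheet = -x.sheet - descent x.pt 0 := rfl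
@[simp] theorem neg_pt (x : UnivCover A) : (-x).pt = -x.pt := rfl

theorem cover_add_comm (x y : UnivCover A) : x + y = y + x := by
  ext
  · have := descent_comm x.pt y.pt
    simp only [add_sheet, add_comm y.pt]
    omega
  · exact add_comm _ _

noncomputable instance : AddCommGroup (UnivCover A) where
  add_assoc x y z := by
    ext
    · have h := descent_add 0 y.pt (y.pt + z.pt) x.pt
      simp only [zero_add, descent_zero, sub_zero] at h
      have e₁ : y.pt + x.pt = x.pt + y.pt := add_comm _ _
      have e₂ : y.pt + z.pt + x.pt = x.pt + (y.pt + z.pt) := add_comm _ _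
      rw [e₁, e₂] at h
      simp only [add_sheet, add_pt, add_assoc x.pt]
      omega
    · exact add_assoc _ _ _
  zero_add x := by ext <;> simp [descent_zero]
  add_zero x := by ext <;> simp [descent_self]
  add_comm := cover_add_comm
  neg_add_cancel x := by
    rw [cover_add_comm]
    ext
    · simp only [add_sheet, neg_sheet, neg_pt, add_neg_cancel, zero_sheet]
      omega
    · simp
  nsmul := nsmulRec
  zsmul := zsmulRec

/-- The embedding of the universal cover into a lexicographic product, as a map of sets. -/
def toLexProd (x : UnivCover A) : ℤ ×ₗ A := toLex (x.sheet, x.pt)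

theorem toLexProd_injective {A : Type*} : Function.Injective (toLexProd (A := A)) := fun x y h => by
  have := congrArg ofLex h
  simp only [toLexProd, ofLex_toLex, Prod.mk.injEq] at this
  exact UnivCover.ext this.1 this.2

noncomputable instance : LinearOrder (UnivCover A) :=
  LinearOrder.lift' toLexProd toLexProd_injective

theorem le_iff (x y : UnivCover A) :
    x ≤ y ↔ x.sheet < y.sheet ∨ x.sheet = y.sheet ∧ x.pt ≤ y.pt :=
  Prod.Lex.le_iff (x := toLexProd x) (y := toLexProd y)

theorem lt_iff (x y : UnivCover A) :
    x < y ↔ x.sheet < y.sheet ∨ x.sheet = y.sheet ∧ x.pt < y.pt :=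
  Prod.Lex.lt_iff (x := toLexProd x) (y := toLexProd y)

instance : IsOrderedAddMonoid (UnivCover A) where
  add_le_add_left x y hxy z := by
    rw [le_iff] at *
    have hx := descent_comm x.pt z.pt
    have hy := descent_comm y.pt z.pt
    -- The carries of `x + z` and `y + z` differ by `descent x.pt y.pt - descent (x.pt + z.pt) (y.pt
    -- + z.pt)`, which is exactly what the lexicographic comparison needs.
    have h := descent_add 0 x.pt y.pt z.pt
    simp only [zero_add, descent_zero, sub_zero] at h
    simp only [add_sheet, add_pt]
    rw [hx, hy]
    unfold descent at *
    rcases hxy with hxy | ⟨h₁, h₂⟩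
    · split_ifs at * with e₁ e₂ e₃ <;> first | omega | skip
      all_goals
      rcases eq_or_lt_of_le (Int.add_one_le_iff.2 hxy) with h' | h'
      · exact Or.inr ⟨by omega, e₁.le.trans (not_lt.1 ‹_›)⟩
      · exact Or.inl (by omega)
    · rw [if_neg h₂.not_gt] at h
      split_ifs at * with e₁ e₂ e₃ e₄ e₅ <;> first | omega | skip
      all_goals exact Or.inr ⟨by omega, not_lt.1 ‹_›⟩

end UnivCover

/-- An unrolling of the oriented group `A`: a linearly ordered abelian group `G` with a positive
element `u` such that `A` is `G ⧸ ℤ u`, together with the bijection from `A` to `[0, u)`. -/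
structure Unrolling (A G : Type*) [OrientedAddCommGroup A] [AddCommGroup G] [LinearOrder G] where
  /-- The length of the circle. -/
  u : G
  /-- The lift of a point of the circle to `[0, u)`. -/
  s : A → G
  s_nonneg : ∀ a, 0 ≤ s a
  s_lt : ∀ a, s a < u
  s_injective : Function.Injective s
  s_add : ∀ a b, s (a + b) = s a + s b ∨ s (a + b) = s a + s b - u
  exists_eq : ∀ g, ∃ (k : ℤ) (a : A), g = s a + k • u
  orient_iff : ∀ a b c, orient a b c ↔
    (s a < s b ∧ s b < s c) ∨ (s b < s c ∧ s c < s a) ∨ (s c < s a ∧ s a < s b)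

/-- Every oriented group is unrolled by its universal cover. -/
noncomputable def univCoverUnrolling (A : Type*) [OrientedAddCommGroup A] :
    Unrolling A (UnivCover A) where
  u := ⟨1, 0⟩
  s a := ⟨0, a⟩
  s_nonneg a := (UnivCover.le_iff _ _).2 (Or.inr ⟨rfl, cut_zero_le a⟩)
  s_lt a := (UnivCover.lt_iff _ _).2 (Or.inl zero_lt_one)
  s_injective a b h := congrArg UnivCover.pt h
  s_add a b := by
    by_cases h : descent a (a + b) = 0
    · left; ext <;> simp [h]
    · right
      have h : descent a (a + b) = 1 := by
        unfold descent at *; split_ifs at * <;> simp_all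
      rw [eq_sub_iff_add_eq]
      ext <;> simp [h, descent_self]
  exists_eq g := by
    have key : ∀ n : ℕ, n • (⟨1, 0⟩ : UnivCover A) = ⟨n, 0⟩ := fun n => by
      induction n with
      | zero => simp only [zero_smul]; rfl
      | succ n ih => rw [succ_nsmul, ih]; ext <;> simp [descent_self]
    refine ⟨g.sheet, g.pt, ?_⟩
    obtain ⟨n, hn | hn⟩ := g.sheet.eq_nat_or_neg
    · rw [hn, natCast_zsmul, key]
      ext <;> simp [hn, descent_self]
    · rw [hn, neg_smul, natCast_zsmul, key, ← sub_eq_add_neg, eq_sub_iff_add_eq]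
      ext <;> simp [hn, descent_self]
  orient_iff a b c := by
    simp only [UnivCover.lt_iff, lt_irrefl, false_or, true_and]
    exact orient_iff_cut

end Unrolling

/-! ### Residues and density of multiples in the unrolling. -/

/-- Every subgroup `n G` with `n > 0` is dense in the ordered group `G`. -/
def DenseMultiples (G : Type*) [AddCommGroup G] [LinearOrder G] : Prop :=
  ∀ n : ℕ, 0 < n → ∀ x y : G, x < y → ∃ g : G, x < n • g ∧ n • g < y

theorem exists_nsmul_eq_of_indexInv {A : Type*} [AddCommGroup A]
    (h : ∀ p : Nat.Primes, indexInv A p = 1) (n : ℕ) (hn : 0 < n) (a : A) :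
    ∃ b : A, n • b = a := by
  induction n using Nat.recOnMul generalizing a with
  | zero => omega
  | one => exact ⟨a, one_smul _ _⟩
  | prime p hp =>
    have h₁ : ENat.card (A ⧸ multiples A p) = 1 := h ⟨p, hp⟩
    have h₂ : Subsingleton (A ⧸ multiples A p) := (ENat.card_le_one_iff_subsingleton _).1 h₁.le
    have h₃ := (QuotientAddGroup.subsingleton_iff (N := multiples A p)).1 h₂
    have h₄ : a ∈ multiples A p := h₃ ▸ AddSubgroup.mem_top a
    obtain ⟨b, hb⟩ := h₄
    exact ⟨b, hb⟩
  | mul k l hk hl =>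
    obtain ⟨b, hb⟩ := hk (Nat.pos_of_mul_pos_right hn) a
    obtain ⟨c, hc⟩ := hl (Nat.pos_of_mul_pos_left hn) b
    exact ⟨c, by rw [mul_smul, hc, hb]⟩

namespace Unrolling

variable {A G : Type*} [OrientedAddCommGroup A] [AddCommGroup G] [LinearOrder G]

theorem u_pos (U : Unrolling A G) : 0 < U.u := (U.s_nonneg 0).trans_lt (U.s_lt 0)

theorem s_zero (U : Unrolling A G) : U.s 0 = 0 := by
  rcases U.s_add 0 0 with h | h
  · simpa using h
  · have := U.s_lt 0
    rw [add_zero] at h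
    have e : U.s 0 = U.u := by
      rw [eq_sub_iff_add_eq] at h
      exact (add_left_cancel h).symm
    exact absurd e this.ne

theorem s_nsmul (U : Unrolling A G) (n : ℕ) (a : A) :
    ∃ k : ℤ, U.s (n • a) = n • U.s a + k • U.u := by
  induction n with
  | zero => exact ⟨0, by simp [U.s_zero]⟩
  | succ n ih =>
    obtain ⟨k, hk⟩ := ih
    rw [succ_nsmul, succ_nsmul]
    rcases U.s_add (n • a) a with h | h
    · exact ⟨k, by rw [h, hk]; abel⟩
    · exact ⟨k - 1, by rw [h, hk, sub_smul, one_smul]; abel⟩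

theorem s_pos (U : Unrolling A G) {a : A} (ha : a ≠ 0) : 0 < U.s a :=
  (U.s_nonneg a).lt_of_ne fun h => ha (U.s_injective (by rw [U.s_zero, h]))

theorem orient_zero_iff (U : Unrolling A G) {a b : A} :
    orient 0 a b ↔ 0 < U.s a ∧ U.s a < U.s b := by
  rw [U.orient_iff, U.s_zero]
  have ha := U.s_nonneg a
  have hb := U.s_nonneg b
  constructor
  · rintro (h | h | h)
    · exact h
    · exact absurd h.2 hb.not_gt
    · exact absurd h.1 hb.not_gt
  · exact Or.inl

/-- Since `A` is `n`-divisible, each `g` is `n • h + k • u`; the class of `k` modulo `n` decides the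
class of `g` modulo `nG`. The map `ρ` comes from a choice of `k` and need not be a homomorphism. -/
theorem exists_residue (U : Unrolling A G) (n : ℕ) (hdiv : ∀ a : A, ∃ b : A, n • b = a) :
    ∃ ρ : G → ZMod n, ∀ g g' : G, ρ g = ρ g' → ∃ h, g - g' = n • h := by
  have key : ∀ g : G, ∃ (k : ℤ) (h : G), g = n • h + k • U.u := fun g => by
    obtain ⟨k, a, hg⟩ := U.exists_eq g
    obtain ⟨b, rfl⟩ := hdiv a
    obtain ⟨l, hl⟩ := U.s_nsmul n b
    exact ⟨l + k, U.s b, by rw [hg, hl, add_smul, add_assoc]⟩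
  choose k h hkh using key
  refine ⟨fun g => (k g : ZMod n), fun g g' hgg' => ?_⟩
  obtain ⟨c, hc⟩ := (ZMod.intCast_eq_intCast_iff_dvd_sub _ _ _).1 hgg'.symm
  refine ⟨h g - h g' + c • U.u, ?_⟩
  have e : n • c • U.u = k g • U.u - k g' • U.u := by
    rw [← natCast_zsmul _ n, smul_smul, ← hc, sub_smul]
  conv_lhs => rw [hkh g, hkh g']
  rw [smul_add, smul_sub, e]
  abel

variable [IsOrderedAddMonoid G]

theorem exists_s_eq (U : Unrolling A G) {g : G} (h₀ : 0 ≤ g) (h₁ : g < U.u) : ∃ a, U.s a = g := by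
  obtain ⟨k, a, hg⟩ := U.exists_eq g
  have ha₀ := U.s_nonneg a
  have ha₁ := U.s_lt a
  have hu := U.u_pos
  rcases lt_trichotomy k 0 with hk | rfl | hk
  · have : k • U.u ≤ (-1 : ℤ) • U.u := zsmul_le_zsmul_left hu.le (by omega)
    rw [neg_one_smul] at this
    have : g < 0 := by
      calc g = U.s a + k • U.u := hg
        _ ≤ U.s a + -U.u := by gcongr
        _ < 0 := by rw [← sub_eq_add_neg]; exact sub_neg.2 ha₁
    exact absurd h₀ this.not_ge
  · exact ⟨a, by simpa using hg.symm⟩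
  · have : (1 : ℤ) • U.u ≤ k • U.u := zsmul_le_zsmul_left hu.le (by omega)
    rw [one_smul] at this
    have : U.u ≤ g := by
      rw [hg]
      exact this.trans (le_add_of_nonneg_left ha₀)
    exact absurd h₁ this.not_gt

/-- The chain of inequalities in regular density says that the multiples of `a` do not wrap around
the circle before `p • a`, so no carry occurs. -/
theorem s_nsmul_of_lt0 (U : Unrolling A G) {p : ℕ} {a : A}
    (h : ∀ i : ℕ, 1 ≤ i → i ≤ p - 1 → lt0 (i • a) ((i + 1) • a)) (hp : 0 < p) :
    U.s (p • a) = p • U.s a := by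
  have key : ∀ i : ℕ, 1 ≤ i → i ≤ p → U.s (i • a) = i • U.s a := by
    intro i hi
    induction i, hi using Nat.le_induction with
    | base => simp
    | succ i hi ih =>
      intro hip
      have h₁ := (U.orient_zero_iff.1 (h i hi (by omega)).2.2.2).2
      rcases U.s_add (i • a) a with h₂ | h₂
      · rw [succ_nsmul, succ_nsmul, h₂, ih (by omega)]
      · rw [succ_nsmul, h₂, add_sub_assoc] at h₁
        have := pos_of_lt_add_right h₁
        exact absurd (U.s_lt a) (sub_pos.1 this).not_gt
  exact key p hp le_rfl

/-- Let `y` be a least positive element. If `2y < u`, regular density at `2` puts a point between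
`y` and `2y`. Otherwise `A = {0, b}` with `2b = 0`, which is not `2`-divisible. -/
theorem exists_pos_lt (U : Unrolling A G) [Nontrivial A] (hA : IsRegularlyDense A)
    (h2 : ∀ a : A, ∃ b : A, 2 • b = a)
    {y : G} (hy : 0 < y) : ∃ z, 0 < z ∧ z < y := by
  by_contra! hmin
  obtain ⟨a, ha⟩ := exists_ne (0 : A)
  have hyu : y < U.u := (hmin _ (U.s_pos ha)).trans_lt (U.s_lt a)
  obtain ⟨b, hb⟩ := U.exists_s_eq hy.le hyu
  have hgap : ∀ g, y < g → y + y ≤ g := fun g hg => by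
    have := hmin _ (sub_pos.2 hg)
    rwa [le_sub_iff_add_le] at this
  rcases lt_or_ge (y + y) U.u with h | h
  · obtain ⟨c, hc⟩ := U.exists_s_eq (add_pos hy hy).le h
    have hbc : orient 0 b c := by
      rw [U.orient_zero_iff, hb, hc]
      exact ⟨hy, lt_add_of_pos_left y hy⟩
    obtain ⟨d, hd, -⟩ := hA 2 Nat.prime_two b c hbc
    rw [U.orient_iff, hb, hc] at hd
    have hyy : y < y + y := lt_add_of_pos_left y hy
    rcases hd with hd | hd | hd
    · exact absurd (hgap _ hd.1) hd.2.not_ge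
    · exact absurd hd.2 hyy.not_gt
    · exact absurd hd.1 hyy.not_gt
  · have htwo : ∀ e : A, e = 0 ∨ e = b := fun e => by
      by_cases he : e = 0
      · exact Or.inl he
      right
      rcases (hmin _ (U.s_pos he)).eq_or_lt with h' | h'
      · exact U.s_injective (by rw [← h', hb])
      · exact absurd (U.s_lt e) (h.trans (hgap _ h')).not_gt
    have hb0 : b ≠ 0 := by
      rintro rfl
      exact hy.ne (U.s_zero.symm.trans hb)
    have hbb : b + b = 0 := by
      rcases htwo (b + b) with h' | h'
      · exact h'
      · exact absurd (by simpa using h') hb0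
    obtain ⟨e, he⟩ := h2 b
    rcases htwo e with rfl | rfl
    · exact hb0 (by simpa using he.symm)
    · exact hb0 (by rw [← he, two_nsmul, hbb])

theorem exists_between_prime (U : Unrolling A G) (hA : IsRegularlyDense A) (hD : DenselyOrdered G)
    {p : ℕ} (hp : p.Prime) (j : ℕ) : ∀ x y : G, j • U.u ≤ x → x < y → y ≤ (j + 1) • U.u →
    ∃ g : G, x < p • g ∧ p • g < y := by
  induction j with
  | zero =>
    intro x y hx hxy hy
    simp only [zero_smul, zero_add, one_smul] at hx hy
    -- Shrinking the interval makes both ends lifts of nonzero points of the circle, even for `x =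
    -- 0` or `y = u`.
    obtain ⟨x', hx', hx'y⟩ := exists_between hxy
    obtain ⟨y', hy', hy'y⟩ := exists_between hx'y
    obtain ⟨a, ha⟩ := U.exists_s_eq (hx.trans hx'.le) (hx'y.trans_le hy)
    obtain ⟨b, hb⟩ := U.exists_s_eq (hx.trans (hx'.trans hy').le) (hy'y.trans_le hy)
    have hab : orient 0 a b := by
      rw [U.orient_zero_iff, ha, hb]
      exact ⟨hx.trans_lt hx', hy'⟩
    obtain ⟨c, hc, hc'⟩ := hA p hp a b hab
    rw [U.orient_iff, U.s_nsmul_of_lt0 hc' hp.pos, ha, hb] at hc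
    refine ⟨U.s c, ?_⟩
    rcases hc with hc | hc | hc
    · exact ⟨hx'.trans hc.1, hc.2.trans hy'y⟩
    · exact absurd hc.2 hy'.not_gt
    · exact absurd hc.1 hy'.not_gt
  | succ j ih =>
    intro x y hx hxy hy
    have hu := U.u_pos
    have e₂ : (j + 1 + 1) • U.u = j • U.u + U.u + U.u := by rw [succ_nsmul, succ_nsmul]
    have e₁ : (j + 1) • U.u = j • U.u + U.u := succ_nsmul _ _
    -- The interval is moved down by an element of `pG`. As `u` itself need not lie in `pG`, a `p •
    -- c` just below `u` is used, close enough that `x - p • c` still falls below `(j + 1) • u`.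
    have base : ∃ g : G, max 0 (U.u - ((j + 1 + 1) • U.u - x)) < p • g ∧ p • g < U.u := by
      have hlt : max 0 (U.u - ((j + 1 + 1) • U.u - x)) < U.u := by
        refine max_lt hu (sub_lt_self _ (sub_pos.2 (hxy.trans_le hy)))
      obtain ⟨x', hx', hx'y⟩ := exists_between hlt
      obtain ⟨y', hy', hy'y⟩ := exists_between hx'y
      have hx'0 := (le_max_left _ _).trans_lt hx'
      obtain ⟨a, ha⟩ := U.exists_s_eq hx'0.le hx'y
      obtain ⟨b, hb⟩ := U.exists_s_eq (hx'0.trans hy').le hy'y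
      have hab : orient 0 a b := by
        rw [U.orient_zero_iff, ha, hb]
        exact ⟨hx'0, hy'⟩
      obtain ⟨c, hc, hc'⟩ := hA p hp a b hab
      rw [U.orient_iff, U.s_nsmul_of_lt0 hc' hp.pos, ha, hb] at hc
      refine ⟨U.s c, ?_⟩
      rcases hc with hc | hc | hc
      · exact ⟨hx'.trans hc.1, hc.2.trans hy'y⟩
      · exact absurd hc.2 hy'.not_gt
      · exact absurd hc.1 hy'.not_gt
    obtain ⟨c, hc, hcu⟩ := base
    have hc := (le_max_right _ _).trans_lt hc
    rw [e₁] at hx ih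
    rw [e₂] at hc
    obtain ⟨g, hg, hg'⟩ := ih (x - p • c) (min (y - p • c) (j • U.u + U.u))
      (by rw [le_sub_iff_add_le]; exact (add_le_add_right hcu.le _).trans hx)
      (by
        refine lt_min (by simpa using hxy) ?_
        rw [sub_sub_eq_add_sub, sub_lt_iff_lt_add'] at hc
        rw [sub_lt_iff_lt_add]
        have h := hc
        rw [← sub_lt_iff_lt_add'] at h
        have e : U.u + x - (j • U.u + U.u + U.u) = x - (j • U.u + U.u) := by abel
        rw [e, sub_lt_iff_lt_add'] at h
        exact h)
      (min_le_right _ _)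
    refine ⟨g + c, ?_, ?_⟩
    · rw [smul_add]
      exact sub_lt_iff_lt_add.1 hg
    · rw [smul_add]
      exact lt_sub_iff_add_lt.1 (hg'.trans_le (min_le_left _ _))

theorem denseMultiples (U : Unrolling A G) [Nontrivial A] (hA : IsRegularlyDense A)
    (hdiv : ∀ n : ℕ, 0 < n → ∀ a : A, ∃ b : A, n • b = a) : DenseMultiples G := by
  have hD : DenselyOrdered G := ⟨fun x y hxy => by
    obtain ⟨z, hz, hz'⟩ := U.exists_pos_lt hA (hdiv 2 two_pos) (sub_pos.2 hxy)
    exact ⟨x + z, lt_add_of_pos_right x hz, by rwa [← lt_sub_iff_add_lt']⟩⟩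
  intro n hn
  induction n using Nat.recOnMul with
  | zero => omega
  | one => simpa using fun x y => exists_between
  | prime p hp =>
    have hpos : ∀ (j : ℕ) (x y : G), j • U.u ≤ x → x < (j + 1) • U.u → x < y →
        ∃ g : G, x < p • g ∧ p • g < y := by
      intro j x y hx hx' hxy
      obtain ⟨g, hg, hg'⟩ := U.exists_between_prime hA hD hp j x (min y ((j + 1) • U.u)) hx
        (lt_min hxy hx') (min_le_right _ _)
      exact ⟨g, hg, hg'.trans_le (min_le_left _ _)⟩
    intro x y hxy
    obtain ⟨k, a, rfl⟩ := U.exists_eq x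
    -- Translating by `p • |k| • u`, an element of `pG`, brings the left end to a nonnegative
    -- position.
    obtain ⟨j, hj⟩ : ∃ j : ℕ, (j : ℤ) = k + p * |k| := by
      refine ⟨(k + p * |k|).toNat, Int.toNat_of_nonneg ?_⟩
      have h₁ : (1 : ℤ) ≤ p := by exact_mod_cast hp.one_lt.le
      nlinarith [neg_abs_le k, abs_nonneg k]
    have e : U.s a + k • U.u + p • |k| • U.u = U.s a + j • U.u := by
      rw [← natCast_zsmul _ j, hj, ← natCast_zsmul _ p, smul_smul, add_smul, add_assoc]
    obtain ⟨g, hg, hg'⟩ := hpos j (U.s a + k • U.u + p • |k| • U.u) (y + p • |k| • U.u)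
      (by rw [e]; exact le_add_of_nonneg_left (U.s_nonneg a))
      (by rw [e, succ_nsmul, add_comm]; gcongr; exact U.s_lt a) (by gcongr)
    refine ⟨g - |k| • U.u, ?_, ?_⟩
    · rwa [smul_sub, lt_sub_iff_add_lt]
    · rwa [smul_sub, sub_lt_iff_lt_add]
  | mul k l hk hl =>
    intro x y hxy
    have hk0 := Nat.pos_of_mul_pos_right hn
    -- Two multiples `k • b < k • c` inside the interval leave room for some `l • g` between `b` and
    -- `c`.
    obtain ⟨b, hb, hb'⟩ := hk hk0 x y hxy
    obtain ⟨c, hc, hc'⟩ := hk hk0 _ y hb'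
    have hbc : b < c := lt_of_not_ge fun h => (nsmul_le_nsmul_right h k).not_gt hc
    obtain ⟨g, hg, hg'⟩ := hl (Nat.pos_of_mul_pos_left hn) b c hbc
    refine ⟨g, ?_, ?_⟩
    · rw [mul_smul]
      exact hb.trans (nsmul_lt_nsmul_right hk0.ne' hg)
    · rw [mul_smul]
      exact (nsmul_lt_nsmul_right hk0.ne' hg').trans hc'

end Unrolling

/-! ### Signs of affine expressions and transport of one element. -/

section Sign

variable {G : Type*} [AddCommGroup G] [LinearOrder G]

theorem sign_eq_iff {x y : G} :
    SignType.sign x = SignType.sign y ↔ (0 < x ↔ 0 < y) ∧ (x < 0 ↔ y < 0) := by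
  rcases lt_trichotomy x 0 with h | h | h <;> rcases lt_trichotomy y 0 with h' | h' | h' <;>
    simp [h, h', h.not_gt, h'.not_gt, sign_pos, sign_neg]

variable [IsOrderedAddMonoid G]

theorem sign_zsmul (k : ℤ) (g : G) :
    SignType.sign (k • g) = SignType.sign k * SignType.sign g := by
  rcases lt_trichotomy k 0 with hk | rfl | hk
  · have h : ∀ x : G, 0 < x → k • x < 0 := fun x hx => by
      have := zsmul_pos hx (neg_pos.2 hk)
      rwa [neg_smul, neg_pos] at this
    rcases lt_trichotomy g 0 with hg | rfl | hg
    · have := h (-g) (neg_pos.2 hg)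
      rw [smul_neg, neg_lt_zero] at this
      rw [sign_pos this, sign_neg hk, sign_neg hg]
      rfl
    · simp
    · rw [sign_neg (h g hg), sign_neg hk, sign_pos hg]
      rfl
  · simp
  · rcases lt_trichotomy g 0 with hg | rfl | hg
    · have := zsmul_pos (neg_pos.2 hg) hk
      rw [smul_neg, neg_pos] at this
      rw [sign_neg this, sign_pos hk, sign_neg hg]
      rfl
    · simp
    · rw [sign_pos (zsmul_pos hg hk), sign_pos hk, sign_pos hg]
      rfl

theorem sign_neg_eq (g : G) : SignType.sign (-g) = -SignType.sign g := by
  simpa using sign_zsmul (-1) g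

/-- Rescaling gives all forms the common leading coefficient `P`, so that their signs record the
position of the single element `P • x` among thresholds `-(q • g)`. -/
theorem sign_zsmul_add {k q P : ℤ} (h : q * k = P) (hP : P ≠ 0) (x g : G) :
    SignType.sign (k • x + g) = SignType.sign q * SignType.sign (P • x - -(q • g)) := by
  have hq : SignType.sign q * SignType.sign q = 1 := by
    have : q ≠ 0 := by rintro rfl; exact hP (by simpa using h.symm)
    rcases lt_or_gt_of_ne this with h' | h'
    · rw [sign_neg h']; rfl
    · rw [sign_pos h']; rfl
  rw [sub_neg_eq_add, ← h, mul_smul, ← smul_add, sign_zsmul q, ← mul_assoc, hq, one_mul]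

theorem exists_common_multiple {ι : Type*} (F : Finset ι) (k : ι → ℤ) :
    ∃ (P : ℕ) (q : ι → ℤ), 0 < P ∧ ∀ i ∈ F, k i ≠ 0 → q i * k i = P := by
  classical
  refine ⟨∏ i ∈ F, if k i = 0 then 1 else (k i).natAbs,
    fun i => (∏ i ∈ F, if k i = 0 then 1 else (k i).natAbs : ℕ) / k i, ?_, fun i hi hk => ?_⟩
  · refine Finset.prod_pos fun i _ => ?_
    split_ifs with h
    · exact one_pos
    · exact Int.natAbs_pos.2 h
  · refine Int.ediv_mul_cancel (Int.natAbs_dvd.1 (Int.natCast_dvd_natCast.2 ?_))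
    have := Finset.dvd_prod_of_mem (fun i => if k i = 0 then 1 else (k i).natAbs) hi
    simpa only [if_neg hk] using this

/-- In an ordered group in which all `n G` are dense, an element `w` can be transported along a
congruent order isomorphism between two finite families of thresholds. -/
theorem exists_transport [Nontrivial G] (hG : DenseMultiples G) {J : Type*} [Finite J] {P M : ℕ}
    (hP : 0 < P) (hM : 0 < M) (θ θ' : J → G)
    (hord : ∀ i j, SignType.sign (θ i - θ j) = SignType.sign (θ' i - θ' j))
    (hres : ∀ j, ∃ g, θ j - θ' j = (M * P) • g) (w : G) :
    ∃ w', (∃ g, w - w' = M • g) ∧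
      ∀ j, SignType.sign (P • w - θ j) = SignType.sign (P • w' - θ' j) := by
  classical
  have := Fintype.ofFinite J
  -- On a threshold, `w'` is forced, and congruence modulo `M * P` allows division by `P`. Off the
  -- thresholds, `P • w'` only has to fall into the corresponding gap of `θ'`, and density of the
  -- multiples of `P * M` finds it there.
  by_cases h : ∃ j, P • w = θ j
  · obtain ⟨j, hj⟩ := h
    obtain ⟨g, hg⟩ := hres j
    have e : P • (w - M • g) = θ' j := by
      rw [smul_sub, smul_smul, mul_comm P, ← hg, hj, sub_sub_cancel]
    exact ⟨w - M • g, ⟨g, sub_sub_cancel _ _⟩, fun i => by rw [hj, e, hord]⟩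
  · push Not at h
    have : DenselyOrdered G := ⟨fun x y hxy => by simpa using hG 1 one_pos x y hxy⟩
    set lo := (Finset.univ.filter fun j => θ j < P • w).image θ' with hlo
    set hi := (Finset.univ.filter fun j => P • w < θ j).image θ' with hhi
    have hlohi : ∀ x ∈ lo, ∀ y ∈ hi, x < y := by
      intro x hx y hy
      simp only [hlo, hhi, Finset.mem_image, Finset.mem_filter, Finset.mem_univ, true_and] at hx hy
      obtain ⟨i, hi, rfl⟩ := hx
      obtain ⟨j, hj, rfl⟩ := hy
      have := (sign_eq_iff.1 (hord i j)).2
      rw [sub_neg, sub_neg] at this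
      exact this.1 (hi.trans hj)
    obtain ⟨x, hx, hx'⟩ := Order.exists_between_finsets lo hi hlohi
    obtain ⟨y, hy, hy'⟩ := Order.exists_between_finsets (insert x lo) hi (by
      intro a ha b hb
      rcases Finset.mem_insert.1 ha with rfl | ha
      · exact hx' b hb
      · exact hlohi a ha b hb)
    have hxy : x < y := hy x (Finset.mem_insert_self _ _)
    obtain ⟨g, hg, hg'⟩ := hG (P * M) (Nat.mul_pos hP hM) (x - P • w) (y - P • w)
      (sub_lt_sub_right hxy _)
    rw [mul_smul, sub_lt_iff_lt_add', ← smul_add] at hg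
    rw [mul_smul, lt_sub_iff_add_lt', ← smul_add] at hg'
    refine ⟨w + M • g, ⟨-g, by simp⟩, fun j => ?_⟩
    rcases lt_or_gt_of_ne (h j) with h₁ | h₁
    · rw [sign_neg (sub_neg.2 h₁), sign_neg]
      exact sub_neg.2 (hg'.trans (hy' _ (Finset.mem_image_of_mem _ (by simpa using h₁))))
    · rw [sign_pos (sub_pos.2 h₁), sign_pos]
      exact sub_pos.2 ((hx _ (Finset.mem_image_of_mem _ (by simpa using h₁))).trans hg)

end Sign

/-! ### Quantifier elimination: formulas depend only on residues and signs. -/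

namespace Unrolling

variable {A G : Type*} [OrientedAddCommGroup A] [AddCommGroup G] [LinearOrder G]
  (U : Unrolling A G) {I : Type*} [Fintype I]

/-- The value at a tuple `v` of the integer affine form with linear coefficients `f.1` and constant
coefficient `f.2`. -/
def form (f : (I → ℤ) × ℤ) (v : I → A) : G := ∑ i, f.1 i • U.s (v i) + f.2 • U.u

theorem form_add (f g : (I → ℤ) × ℤ) (v : I → A) :
    U.form (f + g) v = U.form f v + U.form g v := by
  simp only [form, Prod.fst_add, Prod.snd_add, Pi.add_apply, add_smul, Finset.sum_add_distrib]
  abel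

theorem form_zsmul (k : ℤ) (f : (I → ℤ) × ℤ) (v : I → A) :
    U.form (k • f) v = k • U.form f v := by
  simp only [form, Prod.smul_fst, Prod.smul_snd, Pi.smul_apply, smul_eq_mul, mul_smul, smul_add,
    Finset.smul_sum]

theorem form_sub (f g : (I → ℤ) × ℤ) (v : I → A) :
    U.form (f - g) v = U.form f v - U.form g v := by
  have := U.form_add (f - g) g v
  rw [sub_add_cancel] at this
  rw [this, add_sub_cancel_right]

theorem form_const (k : ℤ) (v : I → A) : U.form (0, k) v = k • U.u := by simp [form]

theorem form_single [DecidableEq I] (i : I) (v : I → A) :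
    U.form (Pi.single i 1, 0) v = U.s (v i) := by
  simp [form, Pi.single_apply, ite_smul]

/-- Two tuples are similar if their lifts are congruent modulo `n` and give the same signs to the
forms in `F`. -/
def Similar (n : ℕ) (F : Finset ((I → ℤ) × ℤ)) (v v' : I → A) : Prop :=
  (∀ i, ∃ g, U.s (v i) - U.s (v' i) = n • g) ∧
    ∀ f ∈ F, SignType.sign (U.form f v) = SignType.sign (U.form f v')

/-- A relation is tame if it respects some similarity relation. -/
def IsTame (R : (I → A) → Prop) : Prop :=
  ∃ (n : ℕ) (F : Finset ((I → ℤ) × ℤ)), 0 < n ∧ ∀ v v', U.Similar n F v v' → R v → R v'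

variable {U}

theorem Similar.symm {n : ℕ} {F : Finset ((I → ℤ) × ℤ)} {v v' : I → A}
    (h : U.Similar n F v v') : U.Similar n F v' v := by
  refine ⟨fun i => ?_, fun f hf => (h.2 f hf).symm⟩
  obtain ⟨g, hg⟩ := h.1 i
  exact ⟨-g, by rw [smul_neg, ← hg, neg_sub]⟩

theorem Similar.mono {n n' : ℕ} {F F' : Finset ((I → ℤ) × ℤ)} {v v' : I → A}
    (h : U.Similar n' F' v v') (hn : n ∣ n') (hF : F ⊆ F') : U.Similar n F v v' := by
  refine ⟨fun i => ?_, fun f hf => h.2 f (hF hf)⟩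
  obtain ⟨g, hg⟩ := h.1 i
  obtain ⟨c, rfl⟩ := hn
  exact ⟨c • g, by rw [hg, mul_smul]⟩

theorem Similar.form_sub_eq {n : ℕ} {F : Finset ((I → ℤ) × ℤ)} {v v' : I → A}
    (h : U.Similar n F v v') (f : (I → ℤ) × ℤ) : ∃ g, U.form f v - U.form f v' = n • g := by
  choose g hg using h.1
  refine ⟨∑ i, f.1 i • g i, ?_⟩
  simp only [form, add_sub_add_right_eq_sub, ← Finset.sum_sub_distrib, ← smul_sub, hg,
    Finset.smul_sum]
  exact Finset.sum_congr rfl fun i _ => smul_comm _ _ _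

theorem isTame_false : U.IsTame fun _ : I → A => False := ⟨1, ∅, one_pos, fun _ _ _ h => h⟩

theorem IsTame.imp {R R' : (I → A) → Prop} (h : U.IsTame R) (h' : U.IsTame R') :
    U.IsTame fun v => R v → R' v := by
  classical
  obtain ⟨n, F, hn, hF⟩ := h
  obtain ⟨n', F', hn', hF'⟩ := h'
  refine ⟨n * n', F ∪ F', Nat.mul_pos hn hn', fun v v' hv hR hRv' => ?_⟩
  exact hF' v v' (hv.mono (dvd_mul_left _ _) Finset.subset_union_right) (hR (hF v' v
    (hv.symm.mono (dvd_mul_right _ _) Finset.subset_union_left) hRv'))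

variable (U) in
theorem s_zero_or_neg [IsOrderedAddMonoid G] (a : A) :
    (U.s a = 0 ∧ U.s (-a) = 0) ∨ (0 < U.s a ∧ U.s (-a) = U.u - U.s a) := by
  by_cases ha : a = 0
  · left
    rw [ha, neg_zero, U.s_zero]
    exact ⟨rfl, rfl⟩
  · right
    have h₁ := U.s_pos ha
    have h₂ := U.s_pos (neg_ne_zero.2 ha)
    refine ⟨h₁, ?_⟩
    rcases U.s_add a (-a) with h | h
    · rw [add_neg_cancel, U.s_zero] at h
      exact absurd h (add_pos h₁ h₂).ne
    · rw [add_neg_cancel, U.s_zero] at h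
      rw [eq_sub_iff_add_eq', ← sub_eq_zero, ← h]

variable (U) in
theorem s_add_eq_ite [IsOrderedAddMonoid G] (a b : A) :
    (U.s a + U.s b - U.u < 0 ∧ U.s (a + b) = U.s a + U.s b) ∨
      (¬ U.s a + U.s b - U.u < 0 ∧ U.s (a + b) = U.s a + U.s b - U.u) := by
  rcases U.s_add a b with h | h
  · left
    exact ⟨sub_neg.2 (h ▸ U.s_lt _), h⟩
  · right
    exact ⟨(h ▸ U.s_nonneg _ : 0 ≤ U.s a + U.s b - U.u).not_gt, h⟩

variable (U) in
/-- The lift of the value of a term is given piecewise by finitely many forms. -/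
theorem exists_forms_term [IsOrderedAddMonoid G] (t : LO.Term I) :
    ∃ F S : Finset ((I → ℤ) × ℤ), ∀ v v' : I → A, U.Similar 1 F v v' →
      ∃ f ∈ S, U.s (t.realize v) = U.form f v ∧ U.s (t.realize v') = U.form f v' := by
  classical
  induction t with
  | var i =>
    exact ⟨∅, {(Pi.single i 1, 0)}, fun v v' _ => ⟨_, Finset.mem_singleton_self _,
      (U.form_single i v).symm, (U.form_single i v').symm⟩⟩
  | func φ ts ih =>
    cases φ with
    | zero =>
      refine ⟨∅, {0}, fun v v' _ => ⟨_, Finset.mem_singleton_self _, ?_⟩⟩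
      have h : ∀ v : I → A, U.s ((Language.Term.func LOFunc.zero ts : LO.Term I).realize v) =
          U.form 0 v := fun v => by
        rw [show (0 : (I → ℤ) × ℤ) = (0, 0) from rfl, form_const, zero_smul]
        exact U.s_zero
      exact ⟨h v, h v'⟩
    | neg =>
      obtain ⟨F, S, h⟩ := ih 0
      -- The sign of `f` tells whether the argument is `0`, the only point at which the lift of `-a`
      -- is not `u - s a`.
      refine ⟨F ∪ S, insert 0 (S.image fun f => (0, 1) - f), fun v v' hv => ?_⟩
      obtain ⟨f, hf, e, e'⟩ := h v v' (hv.mono dvd_rfl Finset.subset_union_left)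
      have hs := (sign_eq_iff.1 (hv.2 f (Finset.mem_union_right _ hf))).1
      rw [← e, ← e'] at hs
      have r : ∀ v : I → A, (Language.Term.func LOFunc.neg ts : LO.Term I).realize v =
        -(ts 0).realize v := fun v => rfl
      simp only [r]
      rcases U.s_zero_or_neg ((ts 0).realize v) with ⟨h₁, h₂⟩ | ⟨h₁, h₂⟩ <;>
        rcases U.s_zero_or_neg ((ts 0).realize v') with ⟨h₁', h₂'⟩ | ⟨h₁', h₂'⟩
      · refine ⟨0, Finset.mem_insert_self _ _, ?_⟩
        rw [show (0 : (I → ℤ) × ℤ) = (0, 0) from rfl, form_const, form_const, zero_smul]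
        exact ⟨h₂, h₂'⟩
      · exact absurd (hs.2 h₁') h₁.not_gt
      · exact absurd (hs.1 h₁) h₁'.not_gt
      · refine ⟨_, Finset.mem_insert_of_mem (Finset.mem_image_of_mem _ hf), ?_⟩
        rw [form_sub, form_sub, form_const, form_const, one_smul, h₂, h₂', e, e']
        exact ⟨rfl, rfl⟩
    | add =>
      obtain ⟨F, S, h⟩ := ih 0
      obtain ⟨F', S', h'⟩ := ih 1
      -- The sign of `f + f' - u` decides the carry, so similar tuples fall into the same branch.
      refine ⟨F ∪ F' ∪ (S ×ˢ S').image fun f => f.1 + f.2 - (0, 1),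
        ((S ×ˢ S').image fun f => f.1 + f.2) ∪ (S ×ˢ S').image fun f => f.1 + f.2 - (0, 1),
        fun v v' hv => ?_⟩
      obtain ⟨f, hf, e₁, e₂⟩ := h v v' (hv.mono dvd_rfl
        (Finset.subset_union_left.trans Finset.subset_union_left))
      obtain ⟨f', hf', e₁', e₂'⟩ := h' v v' (hv.mono dvd_rfl
        (Finset.subset_union_right.trans Finset.subset_union_left))
      have hff : (f, f') ∈ S ×ˢ S' := Finset.mk_mem_product hf hf'
      have hs := (sign_eq_iff.1 (hv.2 (f + f' - (0, 1))
        (Finset.mem_union_right _ (Finset.mem_image_of_mem _ hff)))).2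
      simp only [form_sub, form_add, form_const, one_smul, ← e₁, ← e₂, ← e₁', ← e₂'] at hs
      have r : ∀ v : I → A, (Language.Term.func LOFunc.add ts : LO.Term I).realize v =
        (ts 0).realize v + (ts 1).realize v := fun v => rfl
      simp only [r]
      rcases U.s_add_eq_ite ((ts 0).realize v) ((ts 1).realize v) with ⟨h₁, h₂⟩ | ⟨h₁, h₂⟩ <;>
        rcases U.s_add_eq_ite ((ts 0).realize v') ((ts 1).realize v') with
          ⟨h₁', h₂'⟩ | ⟨h₁', h₂'⟩
      · refine ⟨f + f', Finset.mem_union_left _ (Finset.mem_image_of_mem _ hff), ?_⟩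
        rw [form_add, form_add, h₂, h₂', e₁, e₂, e₁', e₂']
        exact ⟨rfl, rfl⟩
      · exact absurd (hs.1 h₁) h₁'
      · exact absurd (hs.2 h₁') h₁
      · refine ⟨f + f' - (0, 1), Finset.mem_union_right _ (Finset.mem_image_of_mem _ hff), ?_⟩
        rw [form_sub, form_sub, form_add, form_add, form_const, form_const, one_smul, h₂, h₂',
          e₁, e₂, e₁', e₂']
        exact ⟨rfl, rfl⟩

variable (U) in
theorem exists_similar_term_lt [IsOrderedAddMonoid G] (t t' : LO.Term I) :
    ∃ F : Finset ((I → ℤ) × ℤ), ∀ v v' : I → A, U.Similar 1 F v v' →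
      (U.s (t.realize v) < U.s (t'.realize v) ↔ U.s (t.realize v') < U.s (t'.realize v')) := by
  classical
  obtain ⟨F, S, h⟩ := U.exists_forms_term t
  obtain ⟨F', S', h'⟩ := U.exists_forms_term t'
  refine ⟨F ∪ F' ∪ (S ×ˢ S').image fun f => f.1 - f.2, fun v v' hv => ?_⟩
  obtain ⟨f, hf, e₁, e₂⟩ := h v v' (hv.mono dvd_rfl
    (Finset.subset_union_left.trans Finset.subset_union_left))
  obtain ⟨f', hf', e₁', e₂'⟩ := h' v v' (hv.mono dvd_rfl
    (Finset.subset_union_right.trans Finset.subset_union_left))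
  have hs := (sign_eq_iff.1 (hv.2 (f - f') (Finset.mem_union_right _
    (Finset.mem_image_of_mem (fun f : ((I → ℤ) × ℤ) × ((I → ℤ) × ℤ) => f.1 - f.2)
      (Finset.mk_mem_product hf hf'))))).2
  rwa [form_sub, form_sub, ← e₁, ← e₂, ← e₁', ← e₂', sub_neg, sub_neg] at hs

variable (U) in
theorem isTame_term_lt [IsOrderedAddMonoid G] (t t' : LO.Term I) :
    U.IsTame fun v : I → A => U.s (t.realize v) < U.s (t'.realize v) := by
  obtain ⟨F, hF⟩ := U.exists_similar_term_lt t t'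
  exact ⟨1, F, one_pos, fun v v' h => (hF v v' h).1⟩

theorem IsTame.not {R : (I → A) → Prop} (h : U.IsTame R) : U.IsTame fun v => ¬ R v :=
  h.imp isTame_false

theorem IsTame.or {R R' : (I → A) → Prop} (h : U.IsTame R) (h' : U.IsTame R') :
    U.IsTame fun v => R v ∨ R' v := by
  simpa only [← or_iff_not_imp_left] using h.not.imp h'

theorem IsTame.and {R R' : (I → A) → Prop} (h : U.IsTame R) (h' : U.IsTame R') :
    U.IsTame fun v => R v ∧ R' v := by
  simpa only [not_or, not_not] using (h.not.or h'.not).not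

section Quantifier

variable {α : Type*} [Fintype α] {n : ℕ}

/-- The form in the first variables that is left of a form when the last variable is dropped. -/
def initForm (f : (α ⊕ Fin (n + 1) → ℤ) × ℤ) : (α ⊕ Fin n → ℤ) × ℤ :=
  (Sum.elim (fun i => f.1 (Sum.inl i)) fun i => f.1 (Sum.inr i.castSucc), f.2)

/-- The coefficient of the last variable in a form. -/
def lastCoeff (f : (α ⊕ Fin (n + 1) → ℤ) × ℤ) : ℤ := f.1 (Sum.inr (Fin.last n))

theorem form_snoc (f : (α ⊕ Fin (n + 1) → ℤ) × ℤ) (v : α → A) (xs : Fin n → A) (w : A) :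
    U.form f (Sum.elim v (Fin.snoc xs w : Fin (n + 1) → A)) =
      lastCoeff f • U.s w + U.form (initForm f) (Sum.elim v xs) := by
  simp only [form, initForm, lastCoeff, Fintype.sum_sum_type, Sum.elim_inl, Sum.elim_inr,
    Fin.sum_univ_castSucc, Fin.snoc_castSucc, Fin.snoc_last]
  abel

variable [IsOrderedAddMonoid G]

/-- The back-and-forth property of similarity. -/
theorem exists_similar_snoc [Nontrivial G] (hG : DenseMultiples G) {N : ℕ} (hN : 0 < N)
    (F : Finset ((α ⊕ Fin (n + 1) → ℤ) × ℤ)) :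
    ∃ (N' : ℕ) (F' : Finset ((α ⊕ Fin n → ℤ) × ℤ)), 0 < N' ∧
      ∀ (v v' : α → A) (xs xs' : Fin n → A),
        U.Similar N' F' (Sum.elim v xs) (Sum.elim v' xs') → ∀ w : A, ∃ w' : A,
          U.Similar N F (Sum.elim v (Fin.snoc xs w : Fin (n + 1) → A))
            (Sum.elim v' (Fin.snoc xs' w' : Fin (n + 1) → A)) := by
  classical
  -- `X` and `Y` are the forms `s w` and `s w - u`; preserving their signs keeps the transported
  -- element in `[0, u)`, so that it is the lift of a point of `A`.
  let X : (α ⊕ Fin (n + 1) → ℤ) × ℤ := (Pi.single (Sum.inr (Fin.last n)) 1, 0)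
  let Y : (α ⊕ Fin (n + 1) → ℤ) × ℤ := X - (0, 1)
  let E := insert X (insert Y F)
  obtain ⟨P, q, hP, hq⟩ := exists_common_multiple E lastCoeff
  have hP' : (P : ℤ) ≠ 0 := by exact_mod_cast hP.ne'
  -- `T f` is the threshold for `P • s w` attached to `f`. The new data must fix the order of the
  -- thresholds, their classes modulo `N * P`, and the signs of the forms without the last variable.
  let T : (α ⊕ Fin (n + 1) → ℤ) × ℤ → (α ⊕ Fin n → ℤ) × ℤ := fun f => (-q f) • initForm f
  refine ⟨N * P, E.image initForm ∪ (E ×ˢ E).image fun f => T f.1 - T f.2, Nat.mul_pos hN hP,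
    fun v v' xs xs' hv w => ?_⟩
  let J := {f : (α ⊕ Fin (n + 1) → ℤ) × ℤ // f ∈ E ∧ lastCoeff f ≠ 0}
  have : Finite J := Set.Finite.to_subtype (E.finite_toSet.subset fun f hf => hf.1)
  obtain ⟨g, hg, hJ⟩ := exists_transport hG (J := J) hP hN
    (fun f => U.form (T f.1) (Sum.elim v xs)) (fun f => U.form (T f.1) (Sum.elim v' xs'))
    (fun i j => by
      rw [← form_sub, ← form_sub]
      exact hv.2 _ (Finset.mem_union_right _ (Finset.mem_image_of_mem (fun f : _ × _ => T f.1 - T f.2)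
        (Finset.mk_mem_product i.2.1 j.2.1))))
    (fun j => hv.form_sub_eq _) (U.s w)
  have key : ∀ f ∈ E, SignType.sign (lastCoeff f • U.s w + U.form (initForm f) (Sum.elim v xs)) =
      SignType.sign (lastCoeff f • g + U.form (initForm f) (Sum.elim v' xs')) := by
    intro f hf
    by_cases h : lastCoeff f = 0
    · rw [h, zero_smul, zero_smul, zero_add, zero_add]
      exact hv.2 _ (Finset.mem_union_left _ (Finset.mem_image_of_mem _ hf))
    · have := hJ ⟨f, hf, h⟩
      have e : ∀ z : α ⊕ Fin n → A, U.form (T f) z = -(q f • U.form (initForm f) z) := fun z => by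
        rw [← neg_smul]
        exact U.form_zsmul _ _ _
      simp only [e] at this
      rw [sign_zsmul_add (hq f hf h) hP', sign_zsmul_add (hq f hf h) hP', natCast_zsmul,
        natCast_zsmul, this]
  have hX : lastCoeff X = 1 := by simp [X, lastCoeff]
  have hX' : initForm X = (0, 0) := by
    ext i
    · rcases i with i | i <;> simp [initForm, X, Fin.castSucc_ne_last]
    · rfl
  have hY : lastCoeff Y = 1 := by simp [Y, X, lastCoeff]
  have hY' : initForm Y = (0, -1) := by
    ext i
    · rcases i with i | i <;> simp [initForm, Y, X, Fin.castSucc_ne_last]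
    · simp [initForm, Y, X]
  have k₁ := (sign_eq_iff.1 (key X (Finset.mem_insert_self _ _))).2
  have k₂ := (sign_eq_iff.1
    (key Y (Finset.mem_insert_of_mem (Finset.mem_insert_self _ _)))).2
  rw [hX, hX', form_const, form_const, one_smul, one_smul, zero_smul, add_zero, add_zero] at k₁
  rw [hY, hY', form_const, form_const, one_smul, one_smul, neg_one_smul, ← sub_eq_add_neg,
    ← sub_eq_add_neg, sub_neg, sub_neg] at k₂
  obtain ⟨w', rfl⟩ := U.exists_s_eq (not_lt.1 fun h => (U.s_nonneg w).not_gt (k₁.2 h))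
    (k₂.1 (U.s_lt w))
  refine ⟨w', fun i => ?_, fun f hf => ?_⟩
  · rcases i with i | i
    · obtain ⟨c, hc⟩ := hv.1 (Sum.inl i)
      exact ⟨P • c, by rw [smul_smul]; exact hc⟩
    · refine Fin.lastCases ?_ (fun i => ?_) i
      · simpa only [Sum.elim_inr, Fin.snoc_last] using hg
      · obtain ⟨c, hc⟩ := hv.1 (Sum.inr i)
        exact ⟨P • c, by simpa only [smul_smul, Sum.elim_inr, Fin.snoc_castSucc] using hc⟩
  · rw [form_snoc, form_snoc]
    exact key f (Finset.mem_insert_of_mem (Finset.mem_insert_of_mem hf))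

/-- Every formula defines a tame relation. -/
theorem isTame_realize [Nontrivial G] (hG : DenseMultiples G) (φ : LO.BoundedFormula α n) :
    U.IsTame fun z : α ⊕ Fin n → A => φ.Realize (z ∘ Sum.inl) (z ∘ Sum.inr) := by
  induction φ with
  | falsum => exact isTame_false
  | equal t t' =>
    have := (U.isTame_term_lt t t').not.and (U.isTame_term_lt t' t).not
    refine (iff_of_eq (congrArg U.IsTame (funext fun z => propext ?_))).1 this
    rw [not_lt, not_lt, and_comm, ← le_antisymm_iff, U.s_injective.eq_iff]
    change _ ↔ t.realize _ = t'.realize _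
    rw [Sum.elim_comp_inl_inr]
  | rel R ts =>
    cases R with
    | orient =>
      have h := fun i j => U.isTame_term_lt (ts i) (ts j)
      have := ((h 0 1).and (h 1 2)).or (((h 1 2).and (h 2 0)).or ((h 2 0).and (h 0 1)))
      refine (iff_of_eq (congrArg U.IsTame (funext fun z => propext ?_))).1 this
      rw [← U.orient_iff]
      change _ ↔ orient ((ts 0).realize _) ((ts 1).realize _) ((ts 2).realize _)
      rw [Sum.elim_comp_inl_inr]
  | imp φ ψ ih ih' => exact ih.imp ih'
  | all φ ih =>
    obtain ⟨N, F, hN, hF⟩ := ih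
    obtain ⟨N', F', hN', hF'⟩ := exists_similar_snoc (U := U) hG hN F
    refine ⟨N', F', hN', fun v v' hv hR w => ?_⟩
    -- The back-and-forth runs from `v'` to `v`: the witness `w` is given over `v'`, while the
    -- hypothesis holds over `v`.
    obtain ⟨w', hw⟩ := hF' (v' ∘ Sum.inl) (v ∘ Sum.inl) (v' ∘ Sum.inr) (v ∘ Sum.inr)
      (by simpa only [Sum.elim_comp_inl_inr] using hv.symm) w
    exact hF _ _ hw.symm (hR w')

end Quantifier

end Unrolling

/-! ### Counting sign patterns and traces. -/

/-- A finite family of affine forms in `n` variables over an ordered group has at most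
`(2 |J| + 1) ^ n` sign patterns. -/
theorem exists_sign_patterns {G : Type*} [AddCommGroup G] [LinearOrder G] [IsOrderedAddMonoid G]
    {J : Type*} [Fintype J] (n : ℕ) (k : J → Fin n → ℤ) (c : J → G) :
    ∃ S : Finset (J → SignType), S.card ≤ (2 * Fintype.card J + 1) ^ n ∧
      ∀ x : Fin n → G, (fun j => SignType.sign (∑ i, k j i • x i + c j)) ∈ S := by
  classical
  induction n generalizing c with
  | zero => exact ⟨{fun j => SignType.sign (c j)}, by simp, fun x => by simp⟩
  | succ n ih =>
    obtain ⟨P, q, hP, hq⟩ := exists_common_multiple Finset.univ fun j => k j 0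
    have hP' : (P : ℤ) ≠ 0 := by exact_mod_cast hP.ne'
    let kd : Option (J × Bool) → Fin n → ℤ := fun d => d.elim 0 fun i t => q i.1 * k i.1 t.succ
    let cd : Option (J × Bool) → G := fun d => d.elim 0 fun i => q i.1 • c i.1
    choose S hS hS' using fun d : Option (J × Bool) => ih
      (fun j t => if k j 0 = 0 then k j t.succ else kd d t - q j * k j t.succ)
      (fun j => if k j 0 = 0 then c j else cd d - q j • c j)
    -- `Φ d` recovers the original signs from the position `d` and the signs of the reduced forms.
    let Φ : Option (J × Bool) → (J → SignType) → J → SignType := fun d σ j =>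
      if k j 0 = 0 then σ j else SignType.sign (q j) *
        d.elim (-1) fun i => if i.2 then -σ j else if σ j = 1 then -1 else 1
    refine ⟨Finset.univ.biUnion fun d => (S d).image (Φ d), ?_, fun x => ?_⟩
    · calc _ ≤ ∑ d : Option (J × Bool), ((S d).image (Φ d)).card := Finset.card_biUnion_le
        _ ≤ ∑ _d : Option (J × Bool), (2 * Fintype.card J + 1) ^ n :=
          Finset.sum_le_sum fun d _ => Finset.card_image_le.trans (hS d)
        _ = (2 * Fintype.card J + 1) ^ (n + 1) := by
          simp only [Finset.sum_const, Finset.card_univ, Fintype.card_option, Fintype.card_prod,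
            Fintype.card_bool, smul_eq_mul]
          ring
    · let g : J → G := fun j => ∑ i : Fin n, k j i.succ • x i.succ + c j
      let θ : J → G := fun j => -(q j • g j)
      have hg : ∀ j, ∑ i, k j i • x i + c j = k j 0 • x 0 + g j := fun j => by
        rw [Fin.sum_univ_succ, add_assoc]
      let σ : Option (J × Bool) → J → SignType := fun d j =>
        SignType.sign (∑ i : Fin n, (if k j 0 = 0 then k j i.succ else
          kd d i - q j * k j i.succ) • x i.succ + if k j 0 = 0 then c j else cd d - q j • c j)
      have hσ₀ : ∀ d j, k j 0 = 0 → σ d j = SignType.sign (g j) := fun d j h => by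
        simp only [σ, g, if_pos h]
      have hσ₁ : ∀ j₀ b j, k j 0 ≠ 0 → σ (some (j₀, b)) j = SignType.sign (θ j - θ j₀) :=
        fun j₀ b j h => by
          simp only [σ, θ, g, if_neg h, kd, cd, Option.elim_some, sub_smul, mul_smul,
            Finset.sum_sub_distrib, ← Finset.smul_sum, smul_add]
          congr 1
          abel
      suffices h : ∃ d, Φ d (σ d) = fun j => SignType.sign (∑ i, k j i • x i + c j) by
        obtain ⟨d, hd⟩ := h
        rw [← hd]
        exact Finset.mem_biUnion.2 ⟨d, Finset.mem_univ _,
          Finset.mem_image_of_mem _ (hS' d fun i => x i.succ)⟩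
      have reduce : ∀ d, (∀ j, k j 0 ≠ 0 → (d.elim (-1) fun i : J × Bool =>
          if i.2 then -σ d j else if σ d j = 1 then -1 else 1) = SignType.sign (P • x 0 - θ j)) →
          Φ d (σ d) = fun j => SignType.sign (∑ i, k j i • x i + c j) := by
        intro d hd
        funext j
        rw [hg]
        by_cases h : k j 0 = 0
        · simp only [Φ, if_pos h]
          rw [hσ₀ d j h, h, zero_smul, zero_add]
        · simp only [Φ, if_neg h]
          rw [hd j h, sign_zsmul_add (hq j (Finset.mem_univ _) h) hP', natCast_zsmul]
      -- The position is given by the largest threshold not exceeding `P • x 0`, if there is one.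
      let L := Finset.univ.filter fun j => k j 0 ≠ 0 ∧ θ j ≤ P • x 0
      rcases L.eq_empty_or_nonempty with hL | hL
      · refine ⟨none, reduce _ fun j hj => ?_⟩
        have : ¬ θ j ≤ P • x 0 := fun h =>
          Finset.notMem_empty j (hL ▸ Finset.mem_filter.2 ⟨Finset.mem_univ _, hj, h⟩)
        exact (sign_neg (sub_neg.2 (not_le.1 this))).symm
      · obtain ⟨j₀, hj₀, hmax⟩ := L.exists_max_image θ hL
        have hj₀ := (Finset.mem_filter.1 hj₀).2
        refine ⟨some (j₀, decide (P • x 0 = θ j₀)), reduce _ fun j hj => ?_⟩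
        simp only [Option.elim_some, decide_eq_true_eq]
        rw [hσ₁ _ _ j hj]
        split_ifs with h₁ h₂
        · rw [h₁, ← sign_neg_eq, neg_sub]
        · rw [sign_eq_one_iff, sub_pos] at h₂
          refine (sign_neg (sub_neg.2 (not_le.1 fun h => ?_))).symm
          exact (hmax j (Finset.mem_filter.2 ⟨Finset.mem_univ _, hj, h⟩)).not_gt h₂
        · rw [sign_eq_one_iff, sub_pos, not_lt] at h₂
          exact (sign_pos (sub_pos.2 (h₂.trans_lt (hj₀.2.lt_of_ne (Ne.symm h₁))))).symm

/-- The data `δ y` determine the trace of `T y`; an implication suffices in the hypothesis because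
it is symmetric in `y` and `y'`. -/
theorem traces_ncard_le_of_data {X Y D : Type*} {T : Y → Set X} {𝒮 : Set (Set X)}
    (h𝒮 : 𝒮 ⊆ Set.range T) (B : Finset X) (S : Finset D) (δ : Y → D) (hδ : ∀ y, δ y ∈ S)
    (h : ∀ y y', δ y = δ y' → ∀ x ∈ B, x ∈ T y → x ∈ T y') :
    (traces 𝒮 B).ncard ≤ S.card := by
  classical
  let H : D → Set X := fun d => {x | x ∈ B ∧ ∃ y, δ y = d ∧ x ∈ T y}
  have hsub : traces 𝒮 B ⊆ H '' S := by
    rintro C ⟨s, hs, rfl⟩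
    obtain ⟨y, rfl⟩ := h𝒮 hs
    refine ⟨δ y, hδ y, ?_⟩
    ext x
    constructor
    · rintro ⟨hx, y', hy', hxy⟩
      exact ⟨hx, h y' y hy' x hx hxy⟩
    · rintro ⟨hx, hxy⟩
      exact ⟨hx, y, rfl, hxy⟩
  calc _ ≤ (H '' S).ncard := Set.ncard_le_ncard hsub (S.finite_toSet.image _)
    _ ≤ (S : Set D).ncard := Set.ncard_image_le S.finite_toSet
    _ = S.card := Set.ncard_coe_finset S

theorem vcDensity_le_of_traces_le {X : Type*} {𝒮 : Set (Set X)} {n C : ℕ}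
    (h : ∀ B : Finset X, (traces 𝒮 B).ncard ≤ C * (B.card + 1) ^ n) :
    vcDensity 𝒮 ≤ (n : ENNReal) := by
  refine sInf_le ⟨(n : NNReal), by simp, ?_⟩
  refine Asymptotics.IsBigO.of_bound (C * 2 ^ n : ℝ) ?_
  filter_upwards [Filter.eventually_ge_atTop 1] with t ht
  have h₁ : shatterFunction 𝒮 t ≤ C * (t + 1) ^ n := by
    -- No set `B` of size `t` need exist; the supremum is then `0`.
    refine csSup_le' ?_
    rintro k ⟨B, rfl, rfl⟩
    exact h B
  have h₂ : shatterFunction 𝒮 t ≤ C * (2 ^ n * t ^ n) := by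
    refine h₁.trans (Nat.mul_le_mul_left _ ?_)
    rw [← mul_pow]
    exact Nat.pow_le_pow_left (by omega) _
  simp only [NNReal.coe_natCast, Real.rpow_natCast, Real.norm_eq_abs, abs_pow, Nat.abs_cast]
  rw [mul_assoc]
  exact_mod_cast h₂

namespace Unrolling

variable {A G : Type*} [OrientedAddCommGroup A] [AddCommGroup G] [LinearOrder G]
  [IsOrderedAddMonoid G] [Nontrivial G]

theorem vcDensity_definedFamily_le (U : Unrolling A G) (hG : DenseMultiples G)
    (hdiv : ∀ n : ℕ, 0 < n → ∀ a : A, ∃ b : A, n • b = a) {m n : ℕ}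
    (ψ : LO.Formula (Fin m ⊕ Fin n)) : vcDensity (definedFamily A ψ) ≤ (n : ENNReal) := by
  classical
  obtain ⟨N, F, hN, hF⟩ := isTame_realize (U := U) hG ψ
  obtain ⟨ρ, hρ⟩ := U.exists_residue N (hdiv N hN)
  have : NeZero N := ⟨hN.ne'⟩
  -- The factor `N ^ n` counts residues of the lifts of `b`; the rest comes from `2 * (|F| * |B|) +
  -- 1 ≤ (2 * |F| + 1) * (|B| + 1)`.
  refine vcDensity_le_of_traces_le (C := N ^ n * (2 * F.card + 1) ^ n) fun B => ?_
  let z : (Fin m → A) → (Fin n → A) → (Fin m ⊕ Fin n) ⊕ Fin 0 → A := fun a b =>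
    Sum.elim (Sum.elim a b) default
  let k : F × B → Fin n → ℤ := fun j i => j.1.1.1 (Sum.inl (Sum.inr i))
  let c : F × B → G := fun j =>
    ∑ i, j.1.1.1 (Sum.inl (Sum.inl i)) • U.s (j.2.1 i) + j.1.1.2 • U.u
  have hz : ∀ (j : F × B) (b : Fin n → A),
      U.form j.1.1 (z j.2.1 b) = ∑ i, k j i • U.s (b i) + c j := fun j b => by
    simp only [form, z, k, c, Fintype.sum_sum_type, Sum.elim_inl, Sum.elim_inr,
      Finset.univ_eq_empty, Finset.sum_empty, add_zero]
    abel
  obtain ⟨S, hS, hS'⟩ := exists_sign_patterns n k c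
  have key := traces_ncard_le_of_data (T := fun b : Fin n → A =>
      {a : Fin m → A | ψ.Realize (Sum.elim a b)}) (𝒮 := definedFamily A ψ)
    (by rintro _ ⟨b, rfl⟩; exact ⟨b, rfl⟩) B (Finset.univ ×ˢ S)
    (fun b => ((fun i => ρ (U.s (b i)) : Fin n → ZMod N),
      fun j => SignType.sign (∑ i, k j i • U.s (b i) + c j)))
    (fun b => Finset.mk_mem_product (Finset.mem_univ _) (hS' _))
    (by
      intro b b' hbb' a ha hab
      rw [Prod.mk.injEq] at hbb'
      refine hF (z a b) (z a b') ⟨?_, fun f hf => ?_⟩ hab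
      · rintro ((i | i) | i)
        · exact ⟨0, by simp [z]⟩
        · exact hρ _ _ (congrFun hbb'.1 i)
        · exact i.elim0
      · have := congrFun hbb'.2 (⟨f, hf⟩, ⟨a, ha⟩)
        simp only [← hz] at this
        exact this)
  refine key.trans ?_
  rw [Finset.card_product, Finset.card_univ, Fintype.card_pi, Finset.prod_const, Finset.card_univ,
    Fintype.card_fin, ZMod.card, mul_assoc, ← mul_pow]
  refine Nat.mul_le_mul_left _ (hS.trans (Nat.pow_le_pow_left ?_ n))
  rw [Fintype.card_prod, Fintype.card_coe, Fintype.card_coe]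
  nlinarith

end Unrolling

end OrientedGroups

theorem mainTheorem7 (e : Nat.Primes → ℕ∞) (he : e = (fun _ => 0) ∨ e = (fun _ => ⊤))
    (A : Type*) [OrientedGroups.OrientedAddCommGroup A]
    (hA : OrientedGroups.IsModelT A (fun _ => 0) e)
    (m n : ℕ) (ψ : OrientedGroups.LO.Formula (Fin m ⊕ Fin n)) :
    OrientedGroups.vcDensity (OrientedGroups.definedFamily A ψ) ≤ (n : ENNReal) := by
  rcases subsingleton_or_nontrivial A with hA' | hA'
  -- For trivial `A` the cover is a copy of `ℤ`, where density fails; but then `B` has at most one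
  -- point and at most two traces.
  · refine OrientedGroups.vcDensity_le_of_traces_le (C := 2) fun B => ?_
    calc _ ≤ 2 ^ B.card := OrientedGroups.traces_ncard_le _ B
      _ ≤ 2 ^ 1 := Nat.pow_le_pow_right two_pos (Finset.card_le_one_of_subsingleton B)
      _ ≤ 2 * (B.card + 1) ^ n := by
        rw [pow_one]
        exact Nat.le_mul_of_pos_right _ (by positivity)
  · let U := OrientedGroups.univCoverUnrolling A
    have hdiv := OrientedGroups.exists_nsmul_eq_of_indexInv (A := A)
      fun p => by simpa using hA.index p
    have : Nontrivial (OrientedGroups.UnivCover A) := ⟨⟨0, U.u, U.u_pos.ne⟩⟩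
    exact U.vcDensity_definedFamily_le (U.denseMultiples hA.regularlyDense hdiv) hdiv ψ
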